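/- Notation. Let $d \ge 2$ and $0 < n < d$ be integers. $\mathcal{G}(d,n)$ is the Grassmannian of $n$-dimensional linear subspaces of $\mathbb{R}^d$, $\gamma_{d,n}$ its $\mathcal{O}(d)$-invariant Borel probability measure, and $\pi_V\colon\mathbb{R}^d\to V$ the orthogonal projection onto $V\in\mathcal{G}(d,n)$. $\mathcal{H}^{\alpha}$ is $\alpha$-dimensional Hausdorff measure. For a measure $\mu$ on $\mathbb{R}^d$, $\pi_V\mu$ is its push-forward under $\pi_V$, and $\|\pi_V\mu\|_{L^p(V)}$ is the $L^p(V,\mathcal{H}^n)$-norm of its density if $\pi_V\mu\ll\mathcal{H}^n|_V$, and $\infty$ otherwise. $\mathcal{M}_s$ is the class of compactly supported Radon measures $\mu$ on $\mathbb{R}^d$ for which there is a constant $K>0$ with $\mu(B(x,r))\le K r^s$ for all $x\in\mathbb{R}^d$, $r>0$. A nonempty compact set $C\subset\mathbb{R}$ is $\alpha$-regular if there is $K>0$ with $K^{-1}r^{\alpha}\le\mathcal{H}^{\alpha}(C\cap B(x,r))\le K r^{\alpha}$ for all $x\in C$, $0<r\le 1$. Statement. Let $d\ge 2$, $0<n<d$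 and $d-1\le s<d$. (1) There is a nonempty compact $(s-d+1)$-regular set $C\subset[0,1]$; if $s>d-1$, it can be taken to be a Cantor set (perfect and totally disconnected). (2) Let $C\subset\mathbb{R}$ be any nonempty compact $(s-d+1)$-regular set, let $B_{d-1}\subset\mathbb{R}^{d-1}$ be the open unit ball, and let $$\mu:=\mathcal{H}^{s-d+1}|_{C}\times\mathcal{H}^{d-1}|_{B_{d-1}}$$ on $\mathbb{R}\times\mathbb{R}^{d-1}=\mathbb{R}^d$. Then $\mu\in\mathcal{M}_s$, and $$\int_{\mathcal{G}(d,n)}\|\pi_V\mu\|_{L^p(V)}^p\,d\gamma_{d,n}(V)=\infty\qquad\text{for every real } p>\frac{2d-n-s}{d-s}.$$ (3) Consequently, for every real $p>(2d-n-s)/(d-s)$ there is $\mu\in\mathcal{M}_s$ with $\int_{\mathcal{G}(d,n)}\|\pi_V\mu\|_{L^p(V)}^p\,d\gamma_{d,n}(V)=\infty$. In other words, in the range $d-1\le s<d$ the upper bound $(2d-n-s)/(d-s)$ for the exponents $p$ for which this integral is finite for all $\mu\in\mathcal{M}_s$ cannot be increased. -/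

import Mathlib

open MeasureTheory Measure Set
open scoped ENNReal

noncomputable section

namespace ProjLp

/-- `ℝ^d` with its Euclidean structure. -/
abbrev E (d : ℕ) : Type := EuclideanSpace ℝ (Fin d)

/-! ### The Grassmannian and its invariant probability measure -/

/-- The Grassmannian `G(d,n)` of `n`-dimensional linear subspaces of `ℝ^d`. -/
def Gr (d n : ℕ) : Type := {V : Submodule ℝ (E d) // Module.finrank ℝ V = n}

/-- The topology of the metric `‖π_V - π_W‖` (operator norm) on `G(d,n)`. -/
instance (d n : ℕ) : TopologicalSpace (Gr d n) :=
  TopologicalSpace.induced (fun V : Gr d n => V.1.starProjection) inferInstance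

instance (d n : ℕ) : MeasurableSpace (Gr d n) := borel _

instance (d n : ℕ) : BorelSpace (Gr d n) := ⟨rfl⟩

/-- The orthogonal group `O(d)`, with the topology of the operator norm. -/
abbrev O (d : ℕ) : Type := unitary (E d →L[ℝ] E d)

instance (d : ℕ) : ContinuousStar (E d →L[ℝ] E d) :=
  ⟨(ContinuousLinearMap.adjoint : (E d →L[ℝ] E d) ≃ₗᵢ⋆[ℝ] (E d →L[ℝ] E d)).continuous⟩

instance (d : ℕ) : CompactSpace (O d) := by
  refine isCompact_iff_compactSpace.mp (Metric.isCompact_of_isClosed_isBounded ?_ ?_)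
  · exact isClosed_unitary
  · refine (Metric.isBounded_closedBall (x := (0 : E d →L[ℝ] E d)) (r := 1)).subset ?_
    intro g hg
    rw [mem_closedBall_zero_iff]
    refine ContinuousLinearMap.opNorm_le_bound _ zero_le_one fun x => ?_
    have := (Unitary.linearIsometryEquiv (⟨g, hg⟩ : O d)).norm_map x
    rw [one_mul]
    exact this.le

/-- The action `(g, V) ↦ g(V)` of `O(d)` on `G(d,n)`. -/
def rotate {d n : ℕ} (g : O d) (V : Gr d n) : Gr d n :=
  ⟨V.1.map (Unitary.linearIsometryEquiv g).toLinearEquiv.toLinearMap,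
    (LinearEquiv.finrank_map_eq _ V.1).trans V.2⟩

/-- The coordinate plane `ℝ^n × {0} ⊂ ℝ^d`. -/
def basePlane {d n : ℕ} (h : n ≤ d) : Gr d n :=
  ⟨Submodule.span ℝ (range fun i : Fin n => EuclideanSpace.basisFun (Fin d) ℝ (Fin.castLE h i)), by
    rw [finrank_span_eq_card, Fintype.card_fin]
    exact (EuclideanSpace.basisFun (Fin d) ℝ).toBasis.linearIndependent.comp _
      (Fin.castLE_injective h) |> fun h' => by simpa [Function.comp_def] using h'⟩

/-- The normalized Haar measure of `O(d)`. -/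
def haarO (d : ℕ) : Measure (O d) := haarMeasure ⊤

instance (d : ℕ) : IsProbabilityMeasure (haarO d) :=
  ⟨by simpa [haarO] using haarMeasure_self (K₀ := (⊤ : TopologicalSpace.PositiveCompacts (O d)))⟩

/-- The `O(d)`-invariant probability measure `γ_{d,n}` on `G(d,n)`: the law of `g(ℝ^n × {0})` for
a Haar distributed `g ∈ O(d)`. -/
def gammaGr {d n : ℕ} (h : n ≤ d) : Measure (Gr d n) :=
  (haarO d).map fun g => rotate g (basePlane h)

theorem starProjection_rotate {d n : ℕ} (g : O d) (V : Gr d n) :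
    (rotate g V).1.starProjection
      = (g : E d →L[ℝ] E d) * V.1.starProjection * star (g : E d →L[ℝ] E d) := by
  ext1 x
  exact Submodule.starProjection_map_apply (Unitary.linearIsometryEquiv g) V.1 x

theorem continuous_rotate_left {d n : ℕ} (V : Gr d n) : Continuous fun g : O d => rotate g V := by
  refine continuous_induced_rng.mpr ?_
  simp only [Function.comp_def, starProjection_rotate]
  fun_prop

theorem continuous_rotate_right {d n : ℕ} (g : O d) :
    Continuous fun V : Gr d n => rotate g V := by
  refine continuous_induced_rng.mpr ?_
  simp only [Function.comp_def, starProjection_rotate]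
  have : Continuous fun V : Gr d n => V.1.starProjection := continuous_induced_dom
  fun_prop

theorem rotate_mul {d n : ℕ} (g h : O d) (V : Gr d n) :
    rotate (g * h) V = rotate g (rotate h V) := by
  apply Subtype.ext
  simp only [rotate, ← Submodule.map_comp]
  rfl

instance {d n : ℕ} (h : n ≤ d) : IsProbabilityMeasure (gammaGr h) :=
  isProbabilityMeasure_map (continuous_rotate_left _).measurable.aemeasurable

theorem map_rotate_gammaGr {d n : ℕ} (h : n ≤ d) (g : O d) :
    (gammaGr h).map (rotate g) = gammaGr h := by
  have : IsMulLeftInvariant (haarO d) := by unfold haarO; infer_instance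
  have hL := (continuous_rotate_left (basePlane h)).measurable
  rw [gammaGr, map_map (continuous_rotate_right g).measurable hL]
  conv_rhs => rw [← map_mul_left_eq_self (haarO d) g, map_map hL (measurable_const_mul g)]
  congr 1
  funext k
  exact (rotate_mul g k _).symm

/-! ### Frostman measures, projections and `L^p` norms -/

/-- The class `M_s`: compactly supported Radon measures `μ` on `ℝ^d` for which there is `K > 0`
with `μ(B(x,r)) ≤ K r^s` for all `x ∈ ℝ^d` and `r > 0`. -/
structure IsFrostman {d : ℕ} (s : ℝ) (μ : Measure (E d)) : Prop where
  radon : μ.Regular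
  compact_support : ∃ K : Set (E d), IsCompact K ∧ μ Kᶜ = 0
  frostman : ∃ K : ℝ, 0 < K ∧ ∀ (x : E d) (r : ℝ), 0 < r →
    μ (Metric.closedBall x r) ≤ ENNReal.ofReal (K * r ^ s)

/-- The push-forward `π_V μ` of `μ` under the orthogonal projection `π_V : ℝ^d → V`. -/
def proj {d n : ℕ} (μ : Measure (E d)) (V : Gr d n) : Measure V.1 :=
  μ.map V.1.orthogonalProjectionOnto

open Classical in
/-- The `L^p` norm of a measure `ρ` with respect to `m`: the `L^p(m)` norm of its density if
`ρ ≪ m`, and `∞` otherwise. -/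
def measLpNorm {X : Type*} [MeasurableSpace X] (p : ℝ) (ρ m : Measure X) : ℝ≥0∞ :=
  if ρ ≪ m then eLpNorm (ρ.rnDeriv m) (ENNReal.ofReal p) m else ∞

/-- `∫_{G(d,n)} ‖π_V μ‖_{L^p(V)}^p dγ_{d,n}(V)`, where `L^p(V) = L^p(V, H^n)`. -/
def projLpIntegral {d n : ℕ} (h : n ≤ d) (p : ℝ) (μ : Measure (E d)) : ℝ≥0∞ :=
  ∫⁻ V : Gr d n, measLpNorm p (proj μ V) (μH[(n : ℝ)] : Measure V.1) ^ p ∂(gammaGr h)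

/-! ### The example -/

/-- Compact nonempty Ahlfors–David `α`-regular subsets of the line. -/
structure IsRegularSet (α : ℝ) (C : Set ℝ) : Prop where
  compact : IsCompact C
  nonempty : C.Nonempty
  regular : ∃ K : ℝ, 0 < K ∧ ∀ x ∈ C, ∀ r : ℝ, 0 < r → r ≤ 1 →
    ENNReal.ofReal (K⁻¹ * r ^ α) ≤ μH[α] (C ∩ Metric.closedBall x r) ∧
    μH[α] (C ∩ Metric.closedBall x r) ≤ ENNReal.ofReal (K * r ^ α)

/-- The identification `ℝ × ℝ^{d-1} → ℝ^d`, `(t, y) ↦ (t, y_1, …, y_{d-1})`. -/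
def consMap (d : ℕ) (z : ℝ × E (d - 1)) : E d :=
  WithLp.toLp 2 fun i : Fin d => if h : i.val = 0 then z.1 else z.2 ⟨i.val - 1, by omega⟩

/-- The measure `H^{s-d+1}|_C × H^{d-1}|_{B_{d-1}}` on `ℝ × ℝ^{d-1} = ℝ^d`, where `B_{d-1}` is the
open unit ball. -/
def exampleMeasure (d : ℕ) (s : ℝ) (C : Set ℝ) : Measure (E d) :=
  (((μH[s - d + 1] : Measure ℝ).restrict C).prod
    ((μH[(d : ℝ) - 1] : Measure (E (d - 1))).restrict (Metric.ball 0 1))).map (consMap d)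

/-- The identification is measurable, so that the push-forward above is the intended measure. -/
theorem measurable_consMap (d : ℕ) : Measurable (consMap d) := by
  refine Continuous.measurable ?_
  refine (PiLp.continuous_toLp 2 _).comp (continuous_pi fun i => ?_)
  split_ifs <;> fun_prop

end ProjLp

end

open scoped Pointwise

/-! The mass of `μ` sits on slices `{t} × B_{d-1}` with `t ∈ C`, so projections to planes nearly
containing the first coordinate vector `e` are concentrated. Put `u = π_V e` and suppose `‖e - u‖ ≤
δ`. Then `⟨u, (t, y)⟩` equals `t‖u‖²` up to `δ`, so `π_V μ` is carried by a bounded slab in `V` over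
a scaled `2δ`-neighbourhood of `C`. Such a neighbourhood has length at most a constant times
`δ^{1-α} = δ^{d-s}` for `α = s-d+1` (`exists_small_support_proj`). Hölder's inequality turns the
small support into `‖π_V μ‖_p^p ≳ δ^{-(d-s)(p-1)}` (`measure_univ_rpow_le_measLpNorm`).

These planes have `γ`-measure `≳ δ^{d-n}` (`exists_le_gammaGr_near`). The integral is therefore `≳
δ^{(d-n)-(d-s)(p-1)}` for all small `δ`, and the exponent is negative exactly when `p >
(2d-n-s)/(d-s)`.

The Frostman bound is a product estimate. Regular sets of dimension `α ∈ (0,1)` come from the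
two-map self-similar Cantor set of ratio `2^{-1/α}`; for `α = 0` a point suffices. -/

namespace ProjLp

/-! ### Rotations and the measure of planes close to a vector -/

/-- `O(d)` acts transitively on spheres. -/
theorem exists_unitary_apply_eq {d : ℕ} {x y : E d} (h : ‖x‖ = ‖y‖) :
    ∃ g : O d, (g : E d →L[ℝ] E d) x = y := by
  refine ⟨Unitary.linearIsometryEquiv.symm (Submodule.reflection (ℝ ∙ (x - y))ᗮ), ?_⟩
  simpa using Submodule.reflection_sub h

theorem norm_unitary_apply {d : ℕ} (g : O d) (x : E d) : ‖(g : E d →L[ℝ] E d) x‖ = ‖x‖ :=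
  (Unitary.linearIsometryEquiv g).norm_map x

theorem measurePreserving_unitary {d : ℕ} (g : O d) :
    MeasurePreserving (fun x => (g : E d →L[ℝ] E d) x) volume volume :=
  (Unitary.linearIsometryEquiv g).measurePreserving

theorem measurable_unitary_star_apply (d : ℕ) :
    Measurable fun z : O d × E d => (star z.1 : O d).1 z.2 := by
  have hc : Continuous fun z : O d × E d => (star z.1 : O d).1 z.2 := by
    simp only [Unitary.coe_star]
    exact (continuous_star.comp (continuous_subtype_val.comp continuous_fst)).clm_apply
      continuous_snd
  exact hc.measurable

/-- A random rotation of a fixed unit vector hits a cone with probability equal to the proportion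
of the unit ball that lies in the cone. -/
theorem volume_cone_inter_ball {d : ℕ} {T : Set (E d)} (hT : MeasurableSet T)
    (hcone : ∀ (c : ℝ) (x : E d), 0 < c → (c • x ∈ T ↔ x ∈ T)) (hd : 0 < d)
    {e : E d} (he : ‖e‖ = 1) :
    volume (T ∩ Metric.ball 0 1)
      = haarO d {g | (star g : O d).1 e ∈ T} * volume (Metric.ball (0 : E d) 1) := by
  have : Nonempty (Fin d) := ⟨⟨0, hd⟩⟩
  have hinv : IsMulLeftInvariant (haarO d) := by unfold haarO; infer_instance
  -- Fubini on `Z` in two ways: for fixed `g` the slice is a rotated copy of `T ∩ ball`; for fixed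
  -- `y ≠ 0` its Haar measure does not depend on `y`.
  set Z : Set (O d × E d) := {z | (star z.1 : O d).1 z.2 ∈ T}
  have hZ : MeasurableSet Z := measurable_unitary_star_apply d hT
  have h1 : ((haarO d).prod (volume.restrict (Metric.ball (0 : E d) 1))) Z
      = volume (T ∩ Metric.ball 0 1) := by
    rw [Measure.prod_apply hZ]
    have : ∀ g : O d, (volume.restrict (Metric.ball (0 : E d) 1)) (Prod.mk g ⁻¹' Z)
        = volume (T ∩ Metric.ball 0 1) := by
      intro g
      rw [Measure.restrict_apply (measurable_prodMk_left hZ),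
        ← (measurePreserving_unitary (star g)).measure_preimage
          (hT.inter Metric.isOpen_ball.measurableSet).nullMeasurableSet]
      congr 1
      ext y
      have := norm_unitary_apply (star g) y
      simp only [mem_inter_iff, mem_preimage, mem_ofPred_eq, mem_ball_zero_iff, Z, this]
    simp [this]
  rw [← h1, Measure.prod_apply_symm hZ]
  have h2 : ∀ y : E d, y ≠ 0 →
      haarO d ((fun g => (g, y)) ⁻¹' Z) = haarO d {g | (star g : O d).1 e ∈ T} := by
    intro y hy
    have hy' : 0 < ‖y‖ := norm_pos_iff.mpr hy
    obtain ⟨k, hk⟩ := exists_unitary_apply_eq (x := ‖y‖⁻¹ • y) (y := e)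
      (by rw [he, norm_smul, norm_inv, norm_norm, inv_mul_cancel₀ hy'.ne'])
    -- With `k (y/‖y‖) = e`, translating by `k` replaces `e` by `y/‖y‖`, and the cone property
    -- removes the scalar.
    rw [← measure_preimage_mul (haarO d) k {g | (star g : O d).1 e ∈ T}]
    congr 1
    ext g
    have h3 : (star (k * g) : O d).1 e = ‖y‖⁻¹ • (star g : O d).1 y := by
      rw [← hk, star_mul]
      have : (star k : O d).1 (k.1 (‖y‖⁻¹ • y)) = ‖y‖⁻¹ • y := by
        rw [← mul_apply_eq_comp]
        have h4 : (star k : O d).1 * k.1 = 1 := by simp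
        rw [h4]; rfl
      change (star g : O d).1 ((star k : O d).1 (k.1 (‖y‖⁻¹ • y))) = _
      rw [this, map_smul]
    simp only [mem_preimage, mem_ofPred_eq, Z, h3]
    exact (hcone _ _ (inv_pos.mpr hy')).symm
  have h5 : ∀ᵐ y ∂(volume.restrict (Metric.ball (0 : E d) 1)),
      haarO d ((fun g => (g, y)) ⁻¹' Z) = haarO d {g | (star g : O d).1 e ∈ T} := by
    refine ae_restrict_of_ae ?_
    filter_upwards [compl_mem_ae_iff.mpr (measure_singleton (0 : E d))] with y hy
    exact h2 y hy
  rw [lintegral_congr_ae h5]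
  simp

/-- The part of the unit ball at relative distance at most `δ` from a coordinate `n`-plane. -/
theorem exists_le_volume_near_basePlane {d n : ℕ} (hn : 0 < n) (hnd : n < d) :
    ∃ c : ℝ, 0 < c ∧ ∀ δ : ℝ, 0 < δ → δ ≤ 1 →
      ENNReal.ofReal (c * δ ^ (d - n)) ≤ volume ({y : E d |
        ‖y - (basePlane hnd.le).1.starProjection y‖ ≤ δ * ‖y‖} ∩ Metric.ball 0 1) := by
  have hd : (0 : ℝ) < d := by exact_mod_cast hn.trans hnd
  -- The set contains a box with first `n` coordinates in `[a, 2a]` and the others in `[-η, η]`. The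
  -- choice of `a` gives `a ≤ ‖y‖ ≤ 2ad = 1/2`; that of `η` gives distance to the plane at most `dη
  -- = δa ≤ δ‖y‖`.
  set a : ℝ := 1 / (4 * d) with ha
  have ha0 : 0 < a := by positivity
  refine ⟨a ^ n * (2 * a / d) ^ (d - n), by positivity, fun δ hδ hδ1 => ?_⟩
  set η : ℝ := δ * a / d with hη
  have hη0 : 0 < η := by positivity
  set I : Fin d → Set ℝ := fun i => if i.val < n then Icc a (2 * a) else Icc (-η) η with hI
  have hsum : ∀ (z : E d) (t : ℝ), (∀ i, |z i| ≤ t) → ‖z‖ ≤ d * t := by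
    intro z t h
    have hz := (EuclideanSpace.basisFun (Fin d) ℝ).sum_repr z
    rw [← hz]
    refine (norm_sum_le _ _).trans ?_
    refine (Finset.sum_le_card_nsmul _ _ t fun i _ => ?_).trans ?_
    · simpa [norm_smul] using h i
    · simp
  have hsub : (WithLp.ofLp : E d → (Fin d → ℝ)) ⁻¹' (univ.pi I) ⊆ {y : E d |
        ‖y - (basePlane hnd.le).1.starProjection y‖ ≤ δ * ‖y‖} ∩ Metric.ball 0 1 := by
    intro y hy
    have hyi : ∀ i, y i ∈ I i := fun i => hy i (mem_univ i)
    have h1 : ∀ i : Fin d, i.val < n → a ≤ y i ∧ y i ≤ 2 * a := fun i hi => by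
      simpa [hI, hi] using hyi i
    have h2 : ∀ i : Fin d, ¬ i.val < n → |y i| ≤ η := fun i hi => by
      have : y i ∈ Icc (-η) η := by simpa only [hI, hi, if_false] using hyi i
      exact abs_le.mpr this
    have hηa : η ≤ a := by
      have hd1 : (1 : ℝ) ≤ d := by exact_mod_cast hn.trans hnd
      rw [hη, div_le_iff₀ hd]
      nlinarith
    have h3 : ∀ i, |y i| ≤ 2 * a := fun i => by
      by_cases hi : i.val < n
      · rw [abs_of_nonneg (ha0.le.trans (h1 i hi).1)]; exact (h1 i hi).2
      · linarith [h2 i hi]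
    have h4 : ‖y‖ ≤ 1 / 2 := by
      have := hsum y _ h3
      have h5 : (d : ℝ) * (2 * a) = 1 / 2 := by rw [ha]; field_simp; norm_num
      linarith
    have h6 : a ≤ ‖y‖ := by
      have := PiLp.norm_apply_le y (⟨0, hn.trans hnd⟩ : Fin d)
      exact ((h1 ⟨0, hn.trans hnd⟩ hn).1.trans (le_abs_self _)).trans this
    refine ⟨?_, by rw [mem_ball_zero_iff]; linarith⟩
    set w : E d := ∑ i : Fin n, y (Fin.castLE hnd.le i) •
      EuclideanSpace.basisFun (Fin d) ℝ (Fin.castLE hnd.le i) with hw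
    have hwm : w ∈ (basePlane hnd.le).1 :=
      Submodule.sum_mem _ fun i _ => Submodule.smul_mem _ _ (Submodule.subset_span ⟨i, rfl⟩)
    have h7 : ‖y - (basePlane hnd.le).1.starProjection y‖ ≤ ‖y - w‖ := by
      rw [Submodule.starProjection_minimal]
      exact ciInf_le ⟨0, by rintro _ ⟨_, rfl⟩; exact norm_nonneg _⟩
        (⟨w, hwm⟩ : (basePlane hnd.le).1)
    have h8 : ∀ i, |(y - w) i| ≤ η := by
      intro i
      by_cases hi : i.val < n
      · have : w i = y i := by
          simp only [hw, WithLp.ofLp_sum, Finset.sum_apply]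
          rw [Finset.sum_eq_single (⟨i.val, hi⟩ : Fin n)]
          · simp
          · intro j _ hj
            have : i ≠ Fin.castLE hnd.le j := fun h => hj (by ext; simp [h])
            simp [this]
          · simp
        simp [this, hη0.le]
      · have : w i = 0 := by
          simp only [hw, WithLp.ofLp_sum, Finset.sum_apply]
          refine Finset.sum_eq_zero fun j _ => ?_
          have : i ≠ Fin.castLE hnd.le j := fun h => hi (by simp [h])
          simp [this]
        simpa [this] using h2 i hi
    have h9 := hsum _ _ h8
    have h10 : (d : ℝ) * η = δ * a := by rw [hη]; field_simp
    change ‖y - (basePlane hnd.le).1.starProjection y‖ ≤ δ * ‖y‖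
    nlinarith
  refine le_trans (le_of_eq ?_) (measure_mono hsub)
  have hImeas : ∀ i, MeasurableSet (I i) := fun i => by
    simp only [hI]; split_ifs <;> exact measurableSet_Icc
  rw [(PiLp.volume_preserving_ofLp (Fin d)).measure_preimage
    (MeasurableSet.univ_pi hImeas).nullMeasurableSet, volume_pi_pi]
  have hvol : ∀ i, volume (I i) = ENNReal.ofReal (if i.val < n then a else 2 * η) := fun i => by
    simp only [hI]
    split_ifs
    · rw [Real.volume_Icc]; congr 1; ring
    · rw [Real.volume_Icc]; congr 1; ring
  simp only [hvol]
  rw [← ENNReal.ofReal_prod_of_nonneg (fun i _ => by split_ifs <;> positivity)]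
  congr 1
  obtain ⟨m, rfl⟩ := Nat.exists_eq_add_of_lt hnd
  rw [Finset.prod_ite, Finset.prod_const, Finset.prod_const, Finset.filter_not,
    Finset.card_sdiff_of_subset (Finset.filter_subset _ _)]
  have hcard : (Finset.univ.filter fun i : Fin (n + m + 1) => i.val < n).card = n := by
    rw [Fin.card_filter_val_lt]; omega
  rw [hcard, Finset.card_univ, Fintype.card_fin, hη, mul_assoc, ← mul_pow]
  congr 2
  ring

/-- Lower bound for the measure of the `n`-planes at distance at most `δ` from a unit vector. -/
theorem exists_le_gammaGr_near {d n : ℕ} (hn : 0 < n) (hnd : n < d) :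
    ∃ c : ℝ, 0 < c ∧ ∀ (e : E d), ‖e‖ = 1 → ∀ δ : ℝ, 0 < δ → δ ≤ 1 →
      ENNReal.ofReal (c * δ ^ (d - n))
        ≤ gammaGr hnd.le {V : Gr d n | ‖e - V.1.starProjection e‖ ≤ δ} := by
  obtain ⟨c, hc, h⟩ := exists_le_volume_near_basePlane hn hnd
  set v := (volume (Metric.ball (0 : E d) 1)).toReal with hv
  have hvt : volume (Metric.ball (0 : E d) 1) ≠ ∞ := measure_ball_lt_top.ne
  have hv0 : 0 < v := ENNReal.toReal_pos (Metric.measure_ball_pos _ _ one_pos).ne' hvt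
  refine ⟨c / v, by positivity, fun e he δ hδ hδ1 => ?_⟩
  set P := (basePlane hnd.le).1.starProjection
  set T : Set (E d) := {y | ‖y - P y‖ ≤ δ * ‖y‖}
  have hT : MeasurableSet T :=
    (isClosed_le (by fun_prop) (by fun_prop)).measurableSet
  have hcone : ∀ (c : ℝ) (x : E d), 0 < c → (c • x ∈ T ↔ x ∈ T) := by
    intro c x hc
    simp only [T, mem_ofPred_eq, map_smul, ← smul_sub, norm_smul, Real.norm_of_nonneg hc.le]
    rw [mul_left_comm]
    exact mul_le_mul_iff_right₀ hc
  have h1 := (h δ hδ hδ1).trans_eq (volume_cone_inter_ball hT hcone (hn.trans hnd) he)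
  have hmeas : MeasurableSet {V : Gr d n | ‖e - V.1.starProjection e‖ ≤ δ} := by
    have : Continuous fun V : Gr d n => V.1.starProjection := continuous_induced_dom
    exact (isClosed_le (by fun_prop) continuous_const).measurableSet
  rw [gammaGr, Measure.map_apply (continuous_rotate_left _).measurable hmeas]
  -- The rotated plane is `δ`-close to `e` iff the base plane is `δ`-close to `g⁻¹ e`, which turns
  -- the question into the volume of a cone.
  have hset : ((fun g : O d => rotate g (basePlane hnd.le)) ⁻¹'
      {V : Gr d n | ‖e - V.1.starProjection e‖ ≤ δ}) = {g | (star g : O d).1 e ∈ T} := by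
    ext g
    have h2 : e = g.1 ((star g : O d).1 e) := by
      rw [← mul_apply_eq_comp]
      have h4 : g.1 * (star g : O d).1 = 1 := by simp
      rw [h4]; rfl
    have h3 : e - (rotate g (basePlane hnd.le)).1.starProjection e
        = g.1 ((star g : O d).1 e - P ((star g : O d).1 e)) := by
      rw [starProjection_rotate, map_sub, ← h2]
      rfl
    simp only [mem_preimage, mem_ofPred_eq, T, h3, norm_unitary_apply, he, mul_one]
  rw [hset]
  have hvv : volume (Metric.ball (0 : E d) 1) = ENNReal.ofReal v := (ENNReal.ofReal_toReal hvt).symm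
  rw [hvv] at h1
  rw [div_mul_eq_mul_div, ENNReal.ofReal_div_of_pos hv0]
  exact ENNReal.div_le_of_le_mul h1

/-! ### The Hölder inequality for measures with small support -/

/-- Hölder for the density against the indicator of `S`, which carries all of `ρ`. If `ρ` is not
absolutely continuous the right side is `∞`, because `t > 0`. -/
theorem measure_univ_rpow_le_measLpNorm {X : Type*} [MeasurableSpace X] {ρ m : Measure X}
    [IsFiniteMeasure ρ] [SigmaFinite m] {p : ℝ} (hp : 1 < p) {S : Set X} (hS : MeasurableSet S)
    (hρS : ρ Sᶜ = 0) {t : ℝ} (ht : 0 < t) (hmS : m S ≤ ENNReal.ofReal t) :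
    ρ univ ^ p ≤ measLpNorm p ρ m ^ p * ENNReal.ofReal (t ^ (p - 1)) := by
  have hp0 : 0 < p := one_pos.trans hp
  unfold measLpNorm
  split_ifs with hac
  · have h1 : ρ univ = eLpNorm (ρ.rnDeriv m) 1 (m.restrict S) := by
      rw [eLpNorm_one_eq_lintegral_enorm]
      simp only [enorm_eq_self]
      rw [setLIntegral_rnDeriv hac, ← measure_add_measure_compl hS, hρS, add_zero]
    have hp1 : (1 : ℝ≥0∞) ≤ ENNReal.ofReal p := by
      rw [ENNReal.one_le_ofReal]; exact hp.le
    have h2 := eLpNorm_le_eLpNorm_mul_rpow_measure_univ (μ := m.restrict S) hp1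
      (measurable_rnDeriv ρ m).aestronglyMeasurable
    have hexp : 0 ≤ 1 - 1 / p := by
      rw [sub_nonneg, div_le_one hp0]; exact hp.le
    have h3 : ρ univ ≤ eLpNorm (ρ.rnDeriv m) (ENNReal.ofReal p) m
        * ENNReal.ofReal t ^ (1 - 1 / p) := by
      rw [h1]
      refine h2.trans ?_
      rw [ENNReal.toReal_one, ENNReal.toReal_ofReal hp0.le, Measure.restrict_apply_univ, div_one]
      gcongr
      exact Measure.restrict_le_self
    calc ρ univ ^ p ≤ _ := ENNReal.rpow_le_rpow h3 hp0.le
      _ = _ := by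
        rw [ENNReal.mul_rpow_of_nonneg _ _ hp0.le, ← ENNReal.rpow_mul,
          ENNReal.ofReal_rpow_of_pos ht]
        congr 3
        field_simp
  · rw [ENNReal.top_rpow_of_pos hp0, ENNReal.top_mul]
    · exact le_top
    · simpa using Real.rpow_pos_of_pos ht _

/-! ### Regular sets -/

theorem IsRegularSet.measure_lt_top {α : ℝ} {C : Set ℝ} (hC : IsRegularSet α C) :
    μH[α] C < ∞ := by
  obtain ⟨K, hK, h⟩ := hC.regular
  refine hC.compact.measure_lt_top_of_nhdsWithin fun x hx => ?_
  refine ⟨C ∩ Metric.closedBall x 1, Filter.inter_mem self_mem_nhdsWithin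
    (mem_nhdsWithin_of_mem_nhds (Metric.closedBall_mem_nhds x one_pos)), ?_⟩
  exact ((h x hx 1 one_pos le_rfl).2).trans_lt ENNReal.ofReal_lt_top

theorem IsRegularSet.measure_pos {α : ℝ} {C : Set ℝ} (hC : IsRegularSet α C) :
    0 < μH[α] C := by
  obtain ⟨K, hK, h⟩ := hC.regular
  obtain ⟨x, hx⟩ := hC.nonempty
  refine lt_of_lt_of_le ?_ ((h x hx 1 one_pos le_rfl).1.trans (measure_mono inter_subset_left))
  rw [ENNReal.ofReal_pos]
  positivity

/-- Removes the restrictions on centre and radius: a ball meeting `C` lies in one of twice the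
radius centred in `C`, and when `2r > 1` the total mass is a sufficient bound since `(2r)^α ≥ 1`. -/
theorem IsRegularSet.exists_measure_closedBall_le {α : ℝ} (hα : 0 ≤ α) {C : Set ℝ}
    (hC : IsRegularSet α C) :
    ∃ K : ℝ, 0 < K ∧ ∀ (x r : ℝ), 0 < r →
      μH[α] (C ∩ Metric.closedBall x r) ≤ ENNReal.ofReal (K * r ^ α) := by
  obtain ⟨K, hK, h⟩ := hC.regular
  set M := (μH[α] C).toReal with hM
  have hM' : μH[α] C = ENNReal.ofReal M := (ENNReal.ofReal_toReal hC.measure_lt_top.ne).symm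
  refine ⟨(K + M) * 2 ^ α, by positivity, fun x r hr => ?_⟩
  have hrw : (K + M) * 2 ^ α * r ^ α = (K + M) * (2 * r) ^ α := by
    rw [Real.mul_rpow (by norm_num) hr.le]; ring
  have hM0 : 0 ≤ M := ENNReal.toReal_nonneg
  rw [hrw]
  rcases le_or_gt (2 * r) 1 with h1 | h1
  · rcases (C ∩ Metric.closedBall x r).eq_empty_or_nonempty with h0 | ⟨y, hyC, hy⟩
    · simp [h0]
    · have hsub : C ∩ Metric.closedBall x r ⊆ C ∩ Metric.closedBall y (2 * r) := by
        refine inter_subset_inter_right _ (Metric.closedBall_subset_closedBall' ?_)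
        rw [Metric.mem_closedBall, dist_comm] at hy
        linarith
      refine (measure_mono hsub).trans (((h y hyC (2 * r) (by positivity) h1).2).trans ?_)
      refine ENNReal.ofReal_le_ofReal ?_
      gcongr
      linarith
  · refine (measure_mono inter_subset_left).trans ?_
    rw [hM']
    refine ENNReal.ofReal_le_ofReal ?_
    have := Real.one_le_rpow h1.le hα
    nlinarith

/-- Neighbourhoods of an `α`-regular set on the line have small length. -/
theorem IsRegularSet.exists_volume_cthickening_le {α : ℝ} {C : Set ℝ}
    (hC : IsRegularSet α C) :
    ∃ K : ℝ, 0 < K ∧ ∀ δ : ℝ, 0 < δ → δ ≤ 1 →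
      volume (Metric.cthickening δ C) ≤ ENNReal.ofReal (K * δ ^ (1 - α)) := by
  obtain ⟨K, hK, h⟩ := hC.regular
  set M := (μH[α] C).toReal with hM
  have hM' : μH[α] C = ENNReal.ofReal M := (ENNReal.ofReal_toReal hC.measure_lt_top.ne).symm
  have hM0 : 0 < M := ENNReal.toReal_pos hC.measure_pos.ne' hC.measure_lt_top.ne
  refine ⟨4 * M * K, by positivity, fun δ hδ hδ1 => ?_⟩
  set ν : Measure ℝ := (μH[α]).restrict C with hν
  have hfin : IsFiniteMeasure ν := ⟨by simpa [hν] using hC.measure_lt_top⟩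
  -- Fubini replaces a covering argument. Slices over points of `C` have length `4δ`; a slice over a
  -- point of the `δ`-neighbourhood contains a `δ`-ball centred in `C`, of `ν`-mass at least `K⁻¹
  -- δ^α`.
  set Z : Set (ℝ × ℝ) := {z | dist z.1 z.2 ≤ 2 * δ}
  have hZ : MeasurableSet Z := (isClosed_le (by fun_prop) (by fun_prop)).measurableSet
  have h1 : ((volume : Measure ℝ).prod ν) Z = ENNReal.ofReal (4 * δ) * ENNReal.ofReal M := by
    rw [Measure.prod_apply_symm hZ]
    have : ∀ y : ℝ, (volume : Measure ℝ) ((fun x => (x, y)) ⁻¹' Z) = ENNReal.ofReal (4 * δ) := by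
      intro y
      have : (fun x => (x, y)) ⁻¹' Z = Metric.closedBall y (2 * δ) := rfl
      rw [this, Real.volume_closedBall]
      congr 1; ring
    simp [this, hν, hM']
  have hmeas : MeasurableSet (Metric.cthickening δ C) := Metric.isClosed_cthickening.measurableSet
  have h2 : ENNReal.ofReal (K⁻¹ * δ ^ α) * volume (Metric.cthickening δ C)
      ≤ ((volume : Measure ℝ).prod ν) Z := by
    rw [Measure.prod_apply hZ, ← setLIntegral_const]
    refine (setLIntegral_mono' hmeas fun t ht => ?_).trans (setLIntegral_le_lintegral _ _)
    rw [hC.compact.cthickening_eq_biUnion_closedBall hδ.le] at ht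
    simp only [mem_iUnion, exists_prop] at ht
    obtain ⟨x, hxC, hx⟩ := ht
    refine ((h x hxC δ hδ hδ1).1).trans ?_
    rw [hν, Measure.restrict_apply (measurable_prodMk_left hZ), inter_comm]
    refine measure_mono (inter_subset_inter_left _ fun y hy => ?_)
    change dist t y ≤ 2 * δ
    rw [Metric.mem_closedBall] at hx hy
    have := dist_triangle t x y
    rw [dist_comm x y] at this
    linarith
  rw [h1] at h2
  have hpos : 0 < K⁻¹ * δ ^ α := by positivity
  have h3 : volume (Metric.cthickening δ C)
      ≤ ENNReal.ofReal (4 * δ) * ENNReal.ofReal M / ENNReal.ofReal (K⁻¹ * δ ^ α) := by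
    rw [ENNReal.le_div_iff_mul_le (Or.inl (by simpa using hpos)) (Or.inl ENNReal.ofReal_ne_top),
      mul_comm]
    exact h2
  refine h3.trans_eq ?_
  rw [← ENNReal.ofReal_mul (by positivity), ← ENNReal.ofReal_div_of_pos hpos]
  congr 1
  rw [Real.rpow_sub hδ, Real.rpow_one]
  field_simp

/-! ### Slabs in subspaces -/

/-- The `n`-dimensional measure of a slab in an `n`-dimensional subspace. -/
theorem exists_hausdorffMeasure_slab_le (n : ℕ) (R : ℝ) :
    ∃ K : ℝ, 0 < K ∧ ∀ (d : ℕ) (V : Gr d n) (u : V.1), ‖u‖ = 1 → ∀ A : Set ℝ, MeasurableSet A →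
      (μH[(n : ℝ)] : Measure V.1) {v | ‖v‖ ≤ R ∧ inner ℝ u v ∈ A}
        ≤ ENNReal.ofReal K * volume A := by
  set c := (addHaarScalarFactor (μH[(n : ℝ)] : Measure (E n)) volume)
  have hc : (μH[(n : ℝ)] : Measure (E n)) = c • volume := isAddLeftInvariant_eq_smul _ _
  -- In an orthonormal basis starting with `u` the slab lies in `A × [-|R|, |R|]^{n-1}`. The `+ 1`
  -- only makes the constant positive; `n ≥ 1` follows from the existence of a unit vector.
  refine ⟨c * (2 * |R|) ^ (n - 1) + 1, by positivity, fun d V u hu A hA => ?_⟩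
  have hn : 0 < n := by
    rcases Nat.eq_zero_or_pos n with h0 | h0
    · have h1 : Module.finrank ℝ V.1 = 0 := by rw [V.2, h0]
      have := Module.finrank_zero_iff.mp h1
      rw [Subsingleton.elim u 0] at hu
      simp at hu
    · exact h0
  set i₀ : Fin n := ⟨0, hn⟩
  have hon : Orthonormal ℝ (({i₀} : Set (Fin n)).domRestrict fun _ => u) := by
    rw [orthonormal_iff_ite]
    intro i j
    rw [Subsingleton.elim i j]
    have hj : ({i₀} : Set (Fin n)).domRestrict (fun _ => u) j = u := rfl
    rw [if_pos rfl, hj, real_inner_self_eq_norm_sq, hu, one_pow]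
  obtain ⟨b, hb⟩ := hon.exists_orthonormalBasis_extension_of_card_eq
    (by rw [V.2, Fintype.card_fin])
  have hb0 : b i₀ = u := hb i₀ rfl
  set I : Fin n → Set ℝ := fun i => if i = i₀ then A else Icc (-|R|) |R|
  have hI : ∀ i, MeasurableSet (I i) := fun i => by
    simp only [I]; split_ifs; exacts [hA, measurableSet_Icc]
  have hsub : {v : V.1 | ‖v‖ ≤ R ∧ inner ℝ u v ∈ A} ⊆
      b.repr.toIsometryEquiv ⁻¹' ((WithLp.ofLp : E n → (Fin n → ℝ)) ⁻¹' (univ.pi I)) := by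
    rintro v ⟨hv, hvA⟩ i -
    change b.repr v i ∈ I i
    by_cases hi : i = i₀
    · subst hi
      simpa [I, b.repr_apply_apply, hb0] using hvA
    · simp only [I, hi, if_false]
      have h1 := PiLp.norm_apply_le (b.repr v) i
      rw [b.repr.norm_map, Real.norm_eq_abs] at h1
      exact abs_le.mp (h1.trans (hv.trans (le_abs_self R)))
  refine (measure_mono hsub).trans ?_
  rw [IsometryEquiv.hausdorffMeasure_preimage, hc, Measure.smul_apply,
    (PiLp.volume_preserving_ofLp (Fin n)).measure_preimage
    (MeasurableSet.univ_pi hI).nullMeasurableSet, volume_pi_pi,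
    ← Finset.mul_prod_erase _ _ (Finset.mem_univ i₀)]
  have h1 : ∏ i ∈ Finset.univ.erase i₀, volume (I i) = ENNReal.ofReal ((2 * |R|) ^ (n - 1)) := by
    rw [Finset.prod_congr rfl (g := fun _ => ENNReal.ofReal (2 * |R|))]
    · rw [Finset.prod_const, Finset.card_erase_of_mem (Finset.mem_univ _), Finset.card_univ,
        Fintype.card_fin, ENNReal.ofReal_pow (by positivity)]
    · intro i hi
      simp only [I, (Finset.mem_erase.mp hi).1, if_false, Real.volume_Icc]
      congr 1; ring
  rw [h1]
  have h2 : I i₀ = A := by simp [I]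
  rw [h2, ENNReal.smul_def, smul_eq_mul, mul_comm (volume A), ← mul_assoc]
  gcongr
  rw [← ENNReal.ofReal_coe_nnreal, ← ENNReal.ofReal_mul (by positivity)]
  exact ENNReal.ofReal_le_ofReal (by linarith)

/-! ### The identification `ℝ × ℝ^{d-1} = ℝ^d` -/

theorem consMap_sub (d : ℕ) (z w : ℝ × E (d - 1)) :
    consMap d z - consMap d w = consMap d (z - w) := by
  ext i
  simp only [consMap, PiLp.sub_apply]
  split_ifs <;> simp

theorem norm_consMap_sq {d : ℕ} (hd : 0 < d) (z : ℝ × E (d - 1)) :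
    ‖consMap d z‖ ^ 2 = z.1 ^ 2 + ‖z.2‖ ^ 2 := by
  obtain ⟨m, rfl⟩ : ∃ m, d = m + 1 := ⟨d - 1, by omega⟩
  rw [EuclideanSpace.norm_sq_eq, EuclideanSpace.norm_sq_eq, Fin.sum_univ_succ]
  simp [consMap]

theorem consMap_surjective {d : ℕ} (hd : 0 < d) : Function.Surjective (consMap d) := by
  intro x
  refine ⟨(x ⟨0, hd⟩, WithLp.toLp 2 fun i : Fin (d - 1) => x ⟨i.val + 1, by omega⟩), ?_⟩
  ext i
  simp only [consMap]
  split_ifs with h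
  · exact congrArg x (Fin.ext h.symm)
  · exact congrArg x (Fin.ext (Nat.sub_add_cancel (Nat.pos_of_ne_zero h)))

theorem abs_fst_le_norm_consMap {d : ℕ} (hd : 0 < d) (z : ℝ × E (d - 1)) :
    |z.1| ≤ ‖consMap d z‖ := by
  have := norm_consMap_sq hd z
  exact abs_le_of_sq_le_sq (by nlinarith [sq_nonneg ‖z.2‖]) (norm_nonneg _)

theorem norm_snd_le_norm_consMap {d : ℕ} (hd : 0 < d) (z : ℝ × E (d - 1)) :
    ‖z.2‖ ≤ ‖consMap d z‖ := by
  have := norm_consMap_sq hd z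
  exact le_of_sq_le_sq (by nlinarith [sq_nonneg z.1]) (norm_nonneg _)

theorem norm_consMap_le {d : ℕ} (hd : 0 < d) (z : ℝ × E (d - 1)) :
    ‖consMap d z‖ ≤ |z.1| + ‖z.2‖ := by
  have := norm_consMap_sq hd z
  refine le_of_sq_le_sq ?_ (by positivity)
  nlinarith [mul_nonneg (abs_nonneg z.1) (norm_nonneg z.2), sq_abs z.1]

/-- The inner product of a point with a vector `u` close to the first coordinate vector, when `u` is
the projection of the latter. -/
theorem abs_inner_consMap_sub_le {d : ℕ} (hd : 0 < d) (z : ℝ × E (d - 1)) (hz : ‖z.2‖ ≤ 1)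
    {u : E d} (hu : inner ℝ (consMap d (1, 0)) u = ‖u‖ ^ 2) :
    |inner ℝ u (consMap d z) - z.1 * ‖u‖ ^ 2| ≤ ‖consMap d (1, 0) - u‖ := by
  set e := consMap d (1, 0)
  have hsplit : consMap d z = z.1 • e + consMap d (0, z.2) := by
    ext i
    simp only [consMap, PiLp.add_apply, PiLp.smul_apply, e]
    split_ifs <;> simp
  have horth : inner ℝ e (consMap d (0, z.2)) = 0 := by
    rw [PiLp.inner_apply]
    refine Finset.sum_eq_zero fun i _ => ?_
    simp only [consMap, e]
    split_ifs <;> simp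
  have hw : ‖consMap d (0, z.2)‖ ≤ 1 := by
    have := norm_consMap_le hd ((0 : ℝ), z.2)
    simp only [abs_zero, zero_add] at this
    exact this.trans hz
  -- The component `(0, y)` is orthogonal to `e`, so `u` sees it only through `e - u`.
  have h1 : inner ℝ u (consMap d z) - z.1 * ‖u‖ ^ 2
      = - inner ℝ (e - u) (consMap d (0, z.2)) := by
    rw [hsplit, inner_add_right, real_inner_smul_right, real_inner_comm, hu, inner_sub_left,
      horth]
    ring
  rw [h1, abs_neg]
  refine (abs_real_inner_le_norm _ _).trans ?_
  nlinarith [norm_nonneg (e - u)]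

/-! ### The example is a Frostman measure -/

section Example

variable {d : ℕ} {s : ℝ} {C : Set ℝ}

theorem natCast_sub_one_eq_finrank (hd : 0 < d) :
    (d : ℝ) - 1 = (Module.finrank ℝ (E (d - 1)) : ℝ) := by
  rw [finrank_euclideanSpace, Fintype.card_fin, Nat.cast_sub hd, Nat.cast_one]

theorem isAddHaarMeasure_hausdorffMeasure_pred (hd : 0 < d) :
    (μH[(d : ℝ) - 1] : Measure (E (d - 1))).IsAddHaarMeasure := by
  rw [natCast_sub_one_eq_finrank hd]
  infer_instance

theorem IsRegularSet.isFiniteMeasure_restrict {α : ℝ} (hC : IsRegularSet α C) :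
    IsFiniteMeasure ((μH[α] : Measure ℝ).restrict C) :=
  ⟨by simpa using hC.measure_lt_top⟩

theorem isFiniteMeasure_restrict_ball (hd : 0 < d) : IsFiniteMeasure
    ((μH[(d : ℝ) - 1] : Measure (E (d - 1))).restrict (Metric.ball 0 1)) := by
  have := isAddHaarMeasure_hausdorffMeasure_pred hd
  exact ⟨by simpa using measure_ball_lt_top⟩

theorem isFiniteMeasure_exampleMeasure (hd : 0 < d) (hC : IsRegularSet (s - d + 1) C) :
    IsFiniteMeasure (exampleMeasure d s C) := by
  have := hC.isFiniteMeasure_restrict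
  have := isFiniteMeasure_restrict_ball hd
  unfold exampleMeasure
  infer_instance

theorem exampleMeasure_univ_pos (hd : 0 < d) (hC : IsRegularSet (s - d + 1) C) :
    0 < exampleMeasure d s C univ := by
  have := hC.isFiniteMeasure_restrict
  have := isFiniteMeasure_restrict_ball hd
  have := isAddHaarMeasure_hausdorffMeasure_pred hd
  rw [exampleMeasure, Measure.map_apply (measurable_consMap d) MeasurableSet.univ, preimage_univ,
    ← univ_prod_univ, Measure.prod_prod, Measure.restrict_apply_univ, Measure.restrict_apply_univ]
  exact ENNReal.mul_pos hC.measure_pos.ne' (Metric.measure_ball_pos _ _ one_pos).ne'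

/-- The example is carried by the image of `C × B_{d-1}`. -/
theorem exampleMeasure_eq_zero (hd : 0 < d) (hC : IsRegularSet (s - d + 1) C) {N : Set (E d)}
    (hN : MeasurableSet N) (h : ∀ t ∈ C, ∀ y : E (d - 1), ‖y‖ < 1 → consMap d (t, y) ∉ N) :
    exampleMeasure d s C N = 0 := by
  have := hC.isFiniteMeasure_restrict
  have := isFiniteMeasure_restrict_ball hd
  rw [exampleMeasure, Measure.map_apply (measurable_consMap d) hN]
  refine measure_mono_null (t := Cᶜ ×ˢ univ ∪ univ ×ˢ (Metric.ball 0 1)ᶜ) ?_ ?_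
  · rintro ⟨t, y⟩ hz
    by_contra hcon
    simp only [mem_union, mem_prod, mem_univ, and_true, true_and, not_or, mem_compl_iff,
      not_not, mem_ball_zero_iff] at hcon
    exact h t hcon.1 y hcon.2 hz
  · refine measure_union_null ?_ ?_
    · rw [Measure.prod_prod, Measure.restrict_apply hC.compact.measurableSet.compl]
      simp
    · rw [Measure.prod_prod, Measure.restrict_apply Metric.isOpen_ball.measurableSet.compl]
      simp

/-- A ball of radius `r` lies in the product of an interval and a ball of radius `r`, and the
exponents `s-d+1` and `d-1` add up to `s`. -/
theorem isFrostman_exampleMeasure (hd : 0 < d) (hs : (d : ℝ) - 1 ≤ s)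
    (hC : IsRegularSet (s - d + 1) C) : IsFrostman s (exampleMeasure d s C) := by
  have hfinC := hC.isFiniteMeasure_restrict
  have hfinB := isFiniteMeasure_restrict_ball hd
  have hhaar := isAddHaarMeasure_hausdorffMeasure_pred hd
  have hfin := isFiniteMeasure_exampleMeasure hd hC
  obtain ⟨R, hR⟩ := hC.compact.isBounded.exists_norm_le
  refine ⟨inferInstance, ⟨Metric.closedBall 0 (R + 1), isCompact_closedBall _ _, ?_⟩, ?_⟩
  · refine exampleMeasure_eq_zero hd hC Metric.isClosed_closedBall.measurableSet.compl ?_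
    intro t ht y hy
    rw [mem_compl_iff, not_not, mem_closedBall_zero_iff]
    have h1 := norm_consMap_le hd (t, y)
    have h2 := hR t ht
    rw [Real.norm_eq_abs] at h2
    simp only at h1
    linarith
  · obtain ⟨K, hK, h⟩ := hC.exists_measure_closedBall_le (by linarith)
    set ω := ((μH[(d : ℝ) - 1] : Measure (E (d - 1))) (Metric.ball 0 1)).toReal with hω
    have hω' : (μH[(d : ℝ) - 1] : Measure (E (d - 1))) (Metric.ball 0 1) = ENNReal.ofReal ω :=
      (ENNReal.ofReal_toReal measure_ball_lt_top.ne).symm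
    have hω0 : 0 < ω := ENNReal.toReal_pos (Metric.measure_ball_pos _ _ one_pos).ne'
      measure_ball_lt_top.ne
    refine ⟨K * ω, by positivity, fun x r hr => ?_⟩
    obtain ⟨w, rfl⟩ := consMap_surjective hd x
    rw [exampleMeasure, Measure.map_apply (measurable_consMap d)
      Metric.isClosed_closedBall.measurableSet]
    have hsub : consMap d ⁻¹' Metric.closedBall (consMap d w) r
        ⊆ Metric.closedBall w.1 r ×ˢ Metric.closedBall w.2 r := by
      intro z hz
      rw [mem_preimage, Metric.mem_closedBall, dist_eq_norm, consMap_sub] at hz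
      have h1 := abs_fst_le_norm_consMap hd (z - w)
      have h2 := norm_snd_le_norm_consMap hd (z - w)
      rw [mem_prod, Metric.mem_closedBall, Metric.mem_closedBall, dist_eq_norm, dist_eq_norm]
      exact ⟨h1.trans hz, h2.trans hz⟩
    refine (measure_mono hsub).trans ?_
    rw [Measure.prod_prod, Measure.restrict_apply Metric.isClosed_closedBall.measurableSet,
      inter_comm]
    have h2 : ((μH[(d : ℝ) - 1] : Measure (E (d - 1))).restrict (Metric.ball 0 1))
        (Metric.closedBall w.2 r) ≤ ENNReal.ofReal (r ^ ((d : ℝ) - 1) * ω) := by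
      refine (Measure.restrict_le_self _).trans ?_
      rw [addHaar_closedBall _ _ hr.le, hω', natCast_sub_one_eq_finrank hd, Real.rpow_natCast,
        ENNReal.ofReal_mul (by positivity)]
    refine (mul_le_mul' (h w.1 r hr) h2).trans_eq ?_
    rw [← ENNReal.ofReal_mul (by positivity)]
    congr 1
    have : r ^ s = r ^ (s - d + 1) * r ^ ((d : ℝ) - 1) := by
      rw [← Real.rpow_add hr]; congr 1; ring
    rw [this]; ring

/-! ### Divergence of the integral of the projections -/

/-- The projection of the example to a plane close to the first coordinate vector is carried by a
set of small measure. -/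
theorem exists_small_support_proj {n : ℕ} (hd : 0 < d)
    (hC : IsRegularSet (s - d + 1) C) :
    ∃ K : ℝ, 0 < K ∧ ∀ δ : ℝ, 0 < δ → δ ≤ 1 / 2 → ∀ V : Gr d n,
      ‖consMap d (1, 0) - V.1.starProjection (consMap d (1, 0))‖ ≤ δ →
      ∃ S : Set V.1, MeasurableSet S ∧ proj (exampleMeasure d s C) V Sᶜ = 0 ∧
        (μH[(n : ℝ)] : Measure V.1) S ≤ ENNReal.ofReal (K * δ ^ ((d : ℝ) - s)) := by
  obtain ⟨R, hR⟩ := hC.compact.isBounded.exists_norm_le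
  obtain ⟨K₁, hK₁, h₁⟩ := hC.exists_volume_cthickening_le
  obtain ⟨K₂, hK₂, h₂⟩ := exists_hausdorffMeasure_slab_le n (R + 1)
  refine ⟨K₂ * (K₁ * 2 ^ ((d : ℝ) - s)), by positivity, fun δ hδ hδ1 V hV => ?_⟩
  set e := consMap d (1, 0) with he
  set u : V.1 := V.1.orthogonalProjectionOnto e with hu
  have hue : V.1.starProjection e = (u : E d) := rfl
  rw [hue] at hV
  have he1 : ‖e‖ ^ 2 = 1 := by rw [he, norm_consMap_sq hd]; simp
  have hinner : inner ℝ e (u : E d) = ‖(u : E d)‖ ^ 2 := by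
    have h0 : inner ℝ (e - u) (u : E d) = 0 :=
      Submodule.starProjection_inner_eq_zero (K := V.1) e u u.2
    rw [inner_sub_left, real_inner_self_eq_norm_sq] at h0
    linarith
  have hnorm : ‖e - u‖ ^ 2 = 1 - ‖(u : E d)‖ ^ 2 := by
    rw [norm_sub_sq_real, hinner, he1]; ring
  have hun : ‖(u : E d)‖ = ‖u‖ := rfl
  rw [hun] at hinner hnorm
  have hδ2 : ‖e - u‖ ^ 2 ≤ 1 / 4 := by
    have := norm_nonneg (e - u)
    nlinarith
  -- This bound is what limits the error after division by `‖u‖²` to `2δ`.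
  have hu2 : 1 / 2 ≤ ‖u‖ ^ 2 := by linarith
  have hu1 : ‖u‖ ≤ 1 := by
    have := norm_nonneg u
    nlinarith [sq_nonneg ‖e - u‖]
  have hu0 : 0 < ‖u‖ := by
    rcases (norm_nonneg u).eq_or_lt with h | h
    · rw [← h] at hu2; norm_num at hu2
    · exact h
  -- Pairing with the unit vector `u/‖u‖` gives about `t‖u‖`; the extra factor `‖u‖⁻¹` recovers `t`.
  set A : Set ℝ := (fun a => a * ‖u‖⁻¹) ⁻¹' Metric.cthickening (2 * δ) C with hA
  have hAm : MeasurableSet A := by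
    refine measurableSet_preimage (by fun_prop) Metric.isClosed_cthickening.measurableSet
  set S : Set V.1 := {v | ‖v‖ ≤ R + 1 ∧ inner ℝ (‖u‖⁻¹ • u) v ∈ A} with hS
  have hSm : MeasurableSet S := by
    have h0 : Measurable fun v : V.1 => ‖v‖ := by fun_prop
    have h3 : Measurable fun v : V.1 => (inner ℝ (‖u‖⁻¹ • u) v : ℝ) := by fun_prop
    exact (measurableSet_le h0 measurable_const).inter (h3 hAm)
  refine ⟨S, hSm, ?_, ?_⟩
  · rw [proj, Measure.map_apply (by fun_prop) hSm.compl]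
    refine exampleMeasure_eq_zero hd hC (measurableSet_preimage (by fun_prop) hSm.compl) ?_
    intro t ht y hy
    rw [mem_preimage, mem_compl_iff, not_not]
    set x := consMap d (t, y)
    refine ⟨?_, ?_⟩
    · have h3 := norm_consMap_le hd (t, y)
      have h4 := hR t ht
      rw [Real.norm_eq_abs] at h4
      have h5 := V.1.norm_orthogonalProjectionOnto_apply_le x
      simp only at h3
      linarith
    · rw [hA, mem_preimage]
      have h3 : inner ℝ (‖u‖⁻¹ • u) (V.1.orthogonalProjectionOnto x)
          = ‖u‖⁻¹ * inner ℝ (u : E d) x :=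
        (real_inner_smul_left u _ _).trans (congrArg _
          (Submodule.inner_orthogonalProjectionOnto_eq_of_mem_left u x))
      rw [h3]
      refine Metric.mem_cthickening_of_dist_le _ t _ _ ht ?_
      have h4 := abs_inner_consMap_sub_le hd (t, y) hy.le (u := (u : E d)) hinner
      rw [hun] at h4
      rw [Real.dist_eq]
      have h5 : ‖u‖⁻¹ * inner ℝ (u : E d) x * ‖u‖⁻¹ - t
          = (inner ℝ (u : E d) x - t * ‖u‖ ^ 2) / ‖u‖ ^ 2 := by
        field_simp
      rw [h5, abs_div, abs_of_nonneg (sq_nonneg ‖u‖), div_le_iff₀ (by positivity)]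
      have h6 := h4.trans hV
      refine h6.trans ?_
      nlinarith
  · refine (h₂ d V (‖u‖⁻¹ • u) ?_ A hAm).trans ?_
    · rw [norm_smul, norm_inv, norm_norm, inv_mul_cancel₀ hu0.ne']
    rw [hA, Real.volume_preimage_mul_right (inv_ne_zero hu0.ne'), inv_inv, abs_of_pos hu0]
    -- The thickening estimate needs `2δ ≤ 1`, whence the restriction `δ ≤ 1/2`.
    have h3 := h₁ (2 * δ) (by positivity) (by linarith)
    have h4 : ENNReal.ofReal ‖u‖ ≤ 1 := ENNReal.ofReal_le_one.mpr hu1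
    calc _ ≤ ENNReal.ofReal K₂ * (1 * ENNReal.ofReal (K₁ * (2 * δ) ^ (1 - (s - d + 1)))) := by
          gcongr
      _ = _ := by
        rw [one_mul, ← ENNReal.ofReal_mul hK₂.le]
        congr 1
        rw [show 1 - (s - d + 1) = (d : ℝ) - s by ring, Real.mul_rpow (by norm_num) hδ.le]
        ring

/-- Only planes within `δ` of `e` are kept: the Hölder lower bound on each, times the measure of
this set of planes, is unbounded as `δ → 0`. -/
theorem projLpIntegral_exampleMeasure_eq_top {n : ℕ} (hn : 0 < n) (hnd : n < d)
    (hsd : s < d) (hC : IsRegularSet (s - d + 1) C) {p : ℝ}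
    (hp : (2 * d - n - s) / (d - s) < p) :
    projLpIntegral (n := n) hnd.le p (exampleMeasure d s C) = ⊤ := by
  have hd : 0 < d := hn.trans hnd
  have hds : 0 < (d : ℝ) - s := by linarith
  have hnd' : (n : ℝ) < d := by exact_mod_cast hnd
  rw [div_lt_iff₀ hds] at hp
  have hp1 : 1 < p := by
    by_contra hcon
    push Not at hcon
    nlinarith
  have hp0 : 0 < p := one_pos.trans hp1
  have hfin := isFiniteMeasure_exampleMeasure hd hC
  obtain ⟨c, hc, hγ⟩ := exists_le_gammaGr_near hn hnd
  obtain ⟨K, hK, hsupp⟩ := exists_small_support_proj (n := n) hd hC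
  set M := exampleMeasure d s C univ with hM
  have hMt : M ≠ ∞ := measure_ne_top _ _
  have hM0 : M ≠ 0 := (exampleMeasure_univ_pos hd hC).ne'
  set e := consMap d (1, 0) with he
  have he1 : ‖e‖ = 1 := by
    have : ‖e‖ ^ 2 = 1 := by rw [he, norm_consMap_sq hd]; simp
    exact (pow_eq_one_iff_of_nonneg (norm_nonneg e) two_ne_zero).mp this
  -- The surplus of the blow-up rate over the codimension `d - n`; it is positive exactly above the
  -- critical exponent.
  set ε := (d - s) * (p - 1) - (d - n) with hε
  have hε0 : 0 < ε := by rw [hε]; linarith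
  have key : ∀ δ : ℝ, 0 < δ → δ ≤ 1 / 2 →
      M ^ p * ENNReal.ofReal (c * (K ^ (p - 1))⁻¹ * δ ^ (-ε))
        ≤ projLpIntegral (n := n) hnd.le p (exampleMeasure d s C) := by
    intro δ hδ hδ1
    set t := K * δ ^ ((d : ℝ) - s) with ht
    have ht0 : 0 < t := by positivity
    set G : Set (Gr d n) := {V | ‖e - V.1.starProjection e‖ ≤ δ} with hG
    have hmeas : MeasurableSet G := by
      have : Continuous fun V : Gr d n => V.1.starProjection := continuous_induced_dom
      exact (isClosed_le (by fun_prop) continuous_const).measurableSet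
    have h1 : ∀ V ∈ G, M ^ p * ENNReal.ofReal ((t ^ (p - 1))⁻¹)
        ≤ measLpNorm p (proj (exampleMeasure d s C) V) (μH[(n : ℝ)] : Measure V.1) ^ p := by
      intro V hV
      obtain ⟨S, hSm, hS0, hSt⟩ := hsupp δ hδ hδ1 V hV
      have hhaar : (μH[(n : ℝ)] : Measure V.1).IsAddHaarMeasure := by
        have hV := isAddHaarMeasure_hausdorffMeasure (E := V.1)
        rwa [show Module.finrank ℝ V.1 = n from V.2] at hV
      have hpf : IsFiniteMeasure (proj (exampleMeasure d s C) V) := by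
        unfold proj; infer_instance
      have h2 := measure_univ_rpow_le_measLpNorm hp1 hSm hS0 ht0 hSt
      have h3 : proj (exampleMeasure d s C) V univ = M := by
        rw [proj, Measure.map_apply (by fun_prop) MeasurableSet.univ, preimage_univ]
      rw [h3] at h2
      have hpos : 0 < t ^ (p - 1) := by positivity
      rw [ENNReal.ofReal_inv_of_pos hpos, ← div_eq_mul_inv]
      exact ENNReal.div_le_of_le_mul h2
    calc _ = M ^ p * ENNReal.ofReal ((t ^ (p - 1))⁻¹) * ENNReal.ofReal (c * δ ^ (d - n)) := by
          rw [mul_assoc (M ^ p), ← ENNReal.ofReal_mul (by positivity)]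
          congr 2
          rw [ht, Real.mul_rpow hK.le (by positivity), ← Real.rpow_mul hδ.le,
            ← Real.rpow_natCast, Nat.cast_sub hnd.le, hε, neg_sub, Real.rpow_sub hδ]
          field_simp
      _ ≤ M ^ p * ENNReal.ofReal ((t ^ (p - 1))⁻¹) * gammaGr hnd.le G := by
          gcongr
          exact hγ e he1 δ hδ (by linarith)
      _ = ∫⁻ _ in G, M ^ p * ENNReal.ofReal ((t ^ (p - 1))⁻¹) ∂(gammaGr hnd.le) := by
          rw [setLIntegral_const]
      _ ≤ ∫⁻ V in G, measLpNorm p (proj (exampleMeasure d s C) V)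
            (μH[(n : ℝ)] : Measure V.1) ^ p ∂(gammaGr hnd.le) := setLIntegral_mono' hmeas h1
      _ ≤ _ := setLIntegral_le_lintegral _ _
  have hlim : Filter.Tendsto (fun δ : ℝ => M ^ p * ENNReal.ofReal
      (c * (K ^ (p - 1))⁻¹ * δ ^ (-ε))) (nhdsWithin 0 (Ioi 0)) (nhds ⊤) := by
    have h1 : Filter.Tendsto (fun δ : ℝ => c * (K ^ (p - 1))⁻¹ * δ ^ (-ε))
        (nhdsWithin 0 (Ioi 0)) Filter.atTop :=
      (tendsto_rpow_neg_nhdsGT_zero (by linarith)).const_mul_atTop (by positivity)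
    have h2 := ENNReal.Tendsto.const_mul (a := M ^ p) (ENNReal.tendsto_ofReal_atTop.comp h1)
      (Or.inl ENNReal.top_ne_zero)
    rwa [ENNReal.mul_top (by simp [hM0, hMt])] at h2
  refine top_le_iff.mp (le_of_tendsto hlim ?_)
  filter_upwards [Ioc_mem_nhdsGT (show (0 : ℝ) < 1 / 2 by norm_num)] with δ hδ
  exact key δ hδ.1 hδ.2

end Example

/-! ### Topology of regular sets -/

/-- At an isolated point a small ball would meet `C` in a single point, which is `μH[α]`-null for `α
> 0`, against the lower regularity bound. -/
theorem IsRegularSet.perfect {α : ℝ} (hα : 0 < α) {C : Set ℝ} (hC : IsRegularSet α C) :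
    Perfect C := by
  refine ⟨hC.compact.isClosed, fun x hx => ?_⟩
  obtain ⟨K, hK, h⟩ := hC.regular
  rw [accPt_iff_nhds]
  intro U hU
  obtain ⟨ε, hε, hεU⟩ := Metric.nhds_basis_closedBall.mem_iff.mp hU
  by_contra hcon
  push Not at hcon
  have hr : 0 < min ε 1 := lt_min hε one_pos
  have h1 := (h x hx (min ε 1) hr (min_le_right _ _)).1
  have h2 : C ∩ Metric.closedBall x (min ε 1) ⊆ {x} := fun y hy =>
    hcon y ⟨hεU (Metric.closedBall_subset_closedBall (min_le_left _ _) hy.2), hy.1⟩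
  have h3 : μH[α] ({x} : Set ℝ) = 0 := by
    have := nullSingletonClass_hausdorff (X := ℝ) hα
    exact measure_singleton x
  have h4 := h1.trans ((measure_mono h2).trans_eq h3)
  rw [nonpos_iff_eq_zero, ENNReal.ofReal_eq_zero] at h4
  have : 0 < K⁻¹ * min ε 1 ^ α := by positivity
  linarith

/-- Finite `μH[α]` with `α < 1` forces length zero, so `C` contains no interval. -/
theorem IsRegularSet.isTotallyDisconnected {α : ℝ} (hα : α < 1) {C : Set ℝ}
    (hC : IsRegularSet α C) : IsTotallyDisconnected C := by
  intro t htC ht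
  have hvol : volume C = 0 := by
    rw [← hausdorffMeasure_real]
    exact (hausdorffMeasure_zero_or_top hα C).resolve_right hC.measure_lt_top.ne
  have key : ∀ a ∈ t, ∀ b ∈ t, ¬ a < b := by
    intro a ha b hb hab
    have h1 : Icc a b ⊆ C := (ht.ordConnected.out ha hb).trans htC
    have h2 := measure_mono_null h1 hvol
    rw [Real.volume_Icc, ENNReal.ofReal_eq_zero] at h2
    linarith
  intro a ha b hb
  exact le_antisymm (not_lt.mp (key b hb a ha)) (not_lt.mp (key a ha b hb))

theorem isRegularSet_zero_singleton (x : ℝ) : IsRegularSet 0 ({x} : Set ℝ) := by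
  refine ⟨isCompact_singleton, singleton_nonempty x, 1, one_pos, fun y hy r hr _ => ?_⟩
  rw [mem_singleton_iff] at hy
  subst hy
  have : ({y} : Set ℝ) ∩ Metric.closedBall y r = {y} :=
    inter_eq_left.mpr (singleton_subset_iff.mpr (Metric.mem_closedBall_self hr.le))
  simp [this]

/-! ### Self-similar Cantor sets -/

/-- The point of the Cantor set of ratio `l` with address `a`. -/
noncomputable def cantorPoint (l : ℝ) (a : ℕ → Fin 2) : ℝ := ∑' i, (1 - l) * (a i : ℝ) * l ^ i

/-- The self-similar Cantor set generated by the maps `x ↦ l x` and `x ↦ l x + 1 - l`. -/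
def cantor (l : ℝ) : Set ℝ := range (cantorPoint l)

/-- The part of the Cantor set of points whose first `k` digits are those of `a`. -/
def cantorPiece (l : ℝ) (k : ℕ) (a : ℕ → Fin 2) : Set ℝ := cantorPoint l '' PiNat.cylinder a k

theorem coe_fin_two_le_one (j : Fin 2) : (j : ℝ) ≤ 1 := by
  exact_mod_cast Nat.lt_succ_iff.mp j.2

theorem cantorTerm_bounds {l : ℝ} (hl0 : 0 < l) (hl : l < 1) (a : ℕ → Fin 2) (i : ℕ) :
    0 ≤ (1 - l) * (a i : ℝ) * l ^ i ∧ (1 - l) * (a i : ℝ) * l ^ i ≤ (1 - l) * l ^ i := by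
  have h1 : 0 ≤ 1 - l := by linarith
  have h2 := coe_fin_two_le_one (a i)
  refine ⟨by positivity, ?_⟩
  gcongr
  nlinarith

theorem hasSum_cantor_bound {l : ℝ} (hl0 : 0 < l) (hl : l < 1)
    : HasSum (fun i => (1 - l) * l ^ i) 1 := by
  have := (hasSum_geometric_of_lt_one hl0.le hl).mul_left (1 - l)
  rwa [mul_inv_cancel₀ (by linarith)] at this

theorem summable_cantorTerm {l : ℝ} (hl0 : 0 < l) (hl : l < 1) (a : ℕ → Fin 2) :
    Summable fun i => (1 - l) * (a i : ℝ) * l ^ i :=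
  Summable.of_nonneg_of_le (fun i => (cantorTerm_bounds hl0 hl a i).1)
    (fun i => (cantorTerm_bounds hl0 hl a i).2) (hasSum_cantor_bound hl0 hl).summable

theorem cantorPoint_mem_Icc {l : ℝ} (hl0 : 0 < l) (hl : l < 1)
    (a : ℕ → Fin 2) : cantorPoint l a ∈ Icc (0 : ℝ) 1 :=
  ⟨tsum_nonneg fun i => (cantorTerm_bounds hl0 hl a i).1,
    hasSum_le (fun i => (cantorTerm_bounds hl0 hl a i).2) (summable_cantorTerm hl0 hl a).hasSum
      (hasSum_cantor_bound hl0 hl)⟩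

theorem cantorPoint_eq_sum_add {l : ℝ} (hl0 : 0 < l) (hl : l < 1) (a : ℕ → Fin 2) (k : ℕ) :
    cantorPoint l a = ∑ i ∈ Finset.range k, (1 - l) * (a i : ℝ) * l ^ i
      + l ^ k * cantorPoint l fun i => a (i + k) := by
  rw [cantorPoint, ← (summable_cantorTerm hl0 hl a).sum_add_tsum_nat_add k, cantorPoint,
    ← tsum_mul_left]
  congr 2
  ext i
  rw [pow_add]
  ring

theorem continuous_cantorPoint {l : ℝ} (hl0 : 0 < l) (hl : l < 1) : Continuous (cantorPoint l) := by
  refine continuous_tsum (fun i => ?_) (hasSum_cantor_bound hl0 hl).summable fun i a => ?_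
  · have h : Continuous fun j : Fin 2 => (j : ℝ) := continuous_of_discreteTopology
    exact (continuous_const.mul (h.comp (continuous_apply i))).mul continuous_const
  · rw [Real.norm_of_nonneg (cantorTerm_bounds hl0 hl a i).1]
    exact (cantorTerm_bounds hl0 hl a i).2

theorem isCompact_cantor {l : ℝ} (hl0 : 0 < l) (hl : l < 1) : IsCompact (cantor l) :=
  isCompact_range (continuous_cantorPoint hl0 hl)

theorem abs_cantorPoint_sub_le {l : ℝ} (hl0 : 0 < l) (hl : l < 1)
    {a b : ℕ → Fin 2} {k : ℕ} (h : ∀ i < k, a i = b i) :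
    |cantorPoint l a - cantorPoint l b| ≤ l ^ k := by
  rw [cantorPoint_eq_sum_add hl0 hl a k, cantorPoint_eq_sum_add hl0 hl b k,
    Finset.sum_congr rfl fun i hi => by rw [h i (Finset.mem_range.mp hi)], add_sub_add_left_eq_sub,
    ← mul_sub, abs_mul, abs_of_pos (pow_pos hl0 k)]
  have h1 := cantorPoint_mem_Icc hl0 hl fun i => a (i + k)
  have h2 := cantorPoint_mem_Icc hl0 hl fun i => b (i + k)
  have : |(cantorPoint l fun i => a (i + k)) - cantorPoint l fun i => b (i + k)| ≤ 1 :=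
    abs_le.mpr ⟨by linarith [h1.1, h2.2], by linarith [h1.2, h2.1]⟩
  nlinarith [pow_pos hl0 k]

/-- The first differing digit, at index `k`, contributes `(1-l) l^k`, and the tails can cancel at
most `l^{k+1}`. The bound has content only for `2l < 1`. -/
theorem le_abs_cantorPoint_sub {l : ℝ} (hl0 : 0 < l) (hl : l < 1) {a b : ℕ → Fin 2} (hab : a ≠ b) :
    (1 - 2 * l) * l ^ PiNat.firstDiff a b ≤ |cantorPoint l a - cantorPoint l b| := by
  set k := PiNat.firstDiff a b
  have hk : a k ≠ b k := PiNat.apply_firstDiff_ne hab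
  have h : ∀ i < k, a i = b i := fun i hi => PiNat.apply_eq_of_lt_firstDiff hi
  have h1 := cantorPoint_mem_Icc hl0 hl fun i => a (i + (k + 1))
  have h2 := cantorPoint_mem_Icc hl0 hl fun i => b (i + (k + 1))
  rw [cantorPoint_eq_sum_add hl0 hl a (k + 1), cantorPoint_eq_sum_add hl0 hl b (k + 1),
    Finset.sum_range_succ, Finset.sum_range_succ,
    Finset.sum_congr rfl fun i hi => by rw [h i (Finset.mem_range.mp hi)]]
  set x := cantorPoint l fun i => a (i + (k + 1))
  set y := cantorPoint l fun i => b (i + (k + 1))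
  set σ := ∑ i ∈ Finset.range k, (1 - l) * (b i : ℝ) * l ^ i
  have hpk := pow_pos hl0 k
  have hxy : |x - y| ≤ 1 := abs_le.mpr ⟨by linarith [h1.1, h2.2], by linarith [h1.2, h2.1]⟩
  have hdig : |((a k : ℕ) : ℝ) - ((b k : ℕ) : ℝ)| = 1 := by
    generalize a k = i at hk
    generalize b k = j at hk
    fin_cases i <;> fin_cases j <;> simp_all
  have hrw : σ + (1 - l) * ((a k : ℕ) : ℝ) * l ^ k + l ^ (k + 1) * x
      - (σ + (1 - l) * ((b k : ℕ) : ℝ) * l ^ k + l ^ (k + 1) * y)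
      = l ^ k * ((1 - l) * (((a k : ℕ) : ℝ) - ((b k : ℕ) : ℝ)) - l * (y - x)) := by
    rw [pow_succ]; ring
  rw [hrw, abs_mul, abs_of_pos hpk, mul_comm]
  gcongr
  have h3 := abs_sub_abs_le_abs_sub ((1 - l) * (((a k : ℕ) : ℝ) - ((b k : ℕ) : ℝ))) (l * (y - x))
  rw [abs_mul, hdig, abs_of_pos (by linarith : 0 < 1 - l), abs_mul, abs_of_pos hl0,
    abs_sub_comm y x] at h3
  nlinarith

theorem cantorPiece_subset_closedBall {l : ℝ} (hl0 : 0 < l) (hl : l < 1) (k : ℕ) (a : ℕ → Fin 2) :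
    cantorPiece l k a ⊆ Metric.closedBall (cantorPoint l a) (l ^ k) := by
  rintro _ ⟨b, hb, rfl⟩
  exact abs_cantorPoint_sub_le hl0 hl hb

/-- Fixing `k` digits fixes the partial sum and leaves a free tail scaled by `l^k`. Hence the exact
scaling of the Hausdorff measure of pieces. -/
theorem cantorPiece_eq_image {l : ℝ} (hl0 : 0 < l) (hl : l < 1) (k : ℕ) (a : ℕ → Fin 2) :
    ∃ c : ℝ, cantorPiece l k a = (fun x => c + x) '' ((l ^ k : ℝ) • cantor l) := by
  refine ⟨∑ i ∈ Finset.range k, (1 - l) * (a i : ℝ) * l ^ i, ?_⟩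
  ext x
  constructor
  · rintro ⟨b, hb, rfl⟩
    refine ⟨_, ⟨_, ⟨fun i => b (i + k), rfl⟩, rfl⟩, ?_⟩
    rw [cantorPoint_eq_sum_add hl0 hl b k,
      Finset.sum_congr rfl fun i hi => by rw [← hb i (Finset.mem_range.mp hi)]]
    rfl
  · rintro ⟨_, ⟨_, ⟨b, rfl⟩, rfl⟩, rfl⟩
    refine ⟨fun i => if i < k then a i else b (i - k), fun i hi => if_pos hi, ?_⟩
    rw [cantorPoint_eq_sum_add hl0 hl _ k,
      Finset.sum_congr rfl fun i hi => by rw [if_pos (Finset.mem_range.mp hi)]]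
    simp

theorem hausdorffMeasure_cantorPiece {l : ℝ} (hl0 : 0 < l) (hl : l < 1)
    {α : ℝ} (hα : 0 ≤ α) (k : ℕ) (a : ℕ → Fin 2) :
    μH[α] (cantorPiece l k a) = ENNReal.ofReal ((l ^ k) ^ α) * μH[α] (cantor l) := by
  obtain ⟨c, hc⟩ := cantorPiece_eq_image hl0 hl k a
  have hpk := pow_pos hl0 k
  rw [hc, (isometry_add_left c).hausdorffMeasure_image (Or.inl hα),
    hausdorffMeasure_smul₀ hα hpk.ne', ENNReal.smul_def, smul_eq_mul]
  congr 1
  rw [← ENNReal.ofReal_coe_nnreal, NNReal.coe_rpow, coe_nnnorm, Real.norm_of_nonneg hpk.le]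

/-- Cover by the `2^k` pieces of level `k`: each has diameter at most `l^k`, and `(l^k)^α = 2^{-k}`.
-/
theorem hausdorffMeasure_cantor_le_one {l : ℝ} (hl0 : 0 < l) (hl : l < 1)
    {α : ℝ} (hα : 0 < α) (hlα : l ^ α = 1 / 2) :
    μH[α] (cantor l) ≤ 1 := by
  -- The zeros past `k` are arbitrary; they only choose a representative of the cylinder.
  set pad : (k : ℕ) → (Fin k → Fin 2) → ℕ → Fin 2 := fun k w i => if h : i < k then w ⟨i, h⟩ else 0
  have hdiam : ∀ k a, Metric.ediam (cantorPiece l k a) ≤ ENNReal.ofReal (l ^ k) := by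
    intro k a
    refine Metric.ediam_le ?_
    rintro _ ⟨b, hb, rfl⟩ _ ⟨c, hc, rfl⟩
    rw [edist_dist, Real.dist_eq]
    exact ENNReal.ofReal_le_ofReal
      (abs_cantorPoint_sub_le hl0 hl fun i hi => (hb i hi).trans (hc i hi).symm)
  have hlim : Filter.Tendsto (fun k : ℕ => ENNReal.ofReal (l ^ k)) Filter.atTop (nhds 0) := by
    have := ENNReal.tendsto_ofReal (tendsto_pow_atTop_nhds_zero_of_lt_one hl0.le hl)
    simpa using this
  have h := hausdorffMeasure_le_liminf_sum (ι := fun k => (Fin k → Fin 2)) α (cantor l)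
    (fun k : ℕ => ENNReal.ofReal (l ^ k)) hlim (fun k w => cantorPiece l k (pad k w))
    (Filter.Eventually.of_forall fun k w => hdiam k _) (Filter.Eventually.of_forall ?_)
  · refine h.trans ?_
    refine (Filter.liminf_le_liminf (v := fun _ => (1 : ℝ≥0∞))
      (Filter.Eventually.of_forall fun k => ?_)).trans (by simp)
    have h1 : ∀ w : Fin k → Fin 2, Metric.ediam (cantorPiece l k (pad k w)) ^ α
        ≤ ENNReal.ofReal ((1 / 2) ^ k) := by
      intro w
      refine (ENNReal.rpow_le_rpow (hdiam k _) hα.le).trans_eq ?_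
      rw [ENNReal.ofReal_rpow_of_pos (pow_pos hl0 k), ← Real.rpow_natCast, ← Real.rpow_mul hl0.le,
        mul_comm, Real.rpow_mul hl0.le, hlα, Real.rpow_natCast]
    refine (Finset.sum_le_card_nsmul _ _ _ fun w _ => h1 w).trans_eq ?_
    rw [Finset.card_univ, Fintype.card_fun, Fintype.card_fin, Fintype.card_fin, nsmul_eq_mul,
      ← ENNReal.ofReal_natCast, ← ENNReal.ofReal_mul (by positivity)]
    rw [Nat.cast_pow, ← mul_pow]
    norm_num
  · rintro k _ ⟨a, rfl⟩
    refine mem_iUnion.mpr ⟨fun i => a i, a, fun i hi => ?_, rfl⟩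
    simp [pad, hi]

/-- Rereading the digits in base two maps the Cantor set onto `[0,1]`. By the separation estimate
and `l^α = 1/2` this map is `α`-Hölder, so `μH[α]` dominates a multiple of the length of `[0,1]`. -/
theorem hausdorffMeasure_cantor_pos {l : ℝ} (hl0 : 0 < l) (hl : l < 1)
    {α : ℝ} (hα : 0 < α) (hl2 : 2 * l < 1)
    (hlα : l ^ α = 1 / 2) : 0 < μH[α] (cantor l) := by
  have hc : 0 < 1 - 2 * l := by linarith
  have hinj : Function.Injective (cantorPoint l) := by
    intro a b hab
    by_contra hne
    have := le_abs_cantorPoint_sub hl0 hl hne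
    rw [hab, sub_self, abs_zero] at this
    have : 0 < (1 - 2 * l) * l ^ PiNat.firstDiff a b := by positivity
    linarith
  set f : ℝ → ℝ := fun x => Real.ofDigits (Function.invFun (cantorPoint l) x) with hf
  have hfa : ∀ a, f (cantorPoint l a) = Real.ofDigits a := fun a => by
    rw [hf]; simp only [Function.leftInverse_invFun hinj a]
  set K : ℝ := ((1 - 2 * l) ^ α)⁻¹ with hK
  have hK0 : 0 < K := by positivity
  have hhol : HolderOnWith K.toNNReal α.toNNReal f (cantor l) := by
    rintro _ ⟨a, rfl⟩ _ ⟨b, rfl⟩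
    rw [hfa, hfa]
    by_cases hab : a = b
    · simp [hab]
    have h1 : |Real.ofDigits a - Real.ofDigits b| ≤ ((2 : ℕ) ^ PiNat.firstDiff a b : ℝ)⁻¹ :=
      Real.abs_ofDigits_sub_ofDigits_le fun i hi => PiNat.apply_eq_of_lt_firstDiff hi
    have h2 := le_abs_cantorPoint_sub hl0 hl hab
    set k := PiNat.firstDiff a b
    have h3 : ((2 : ℕ) ^ k : ℝ)⁻¹ = (l ^ k) ^ α := by
      rw [← Real.rpow_natCast l, ← Real.rpow_mul hl0.le, mul_comm, Real.rpow_mul hl0.le, hlα,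
        Real.rpow_natCast]
      simp
    have h4 : (l ^ k) ^ α ≤ K * |cantorPoint l a - cantorPoint l b| ^ α := by
      have h5 := Real.rpow_le_rpow (by positivity) h2 hα.le
      rw [Real.mul_rpow hc.le (by positivity)] at h5
      rw [hK, ← div_eq_inv_mul, le_div_iff₀ (by positivity), mul_comm]
      exact h5
    rw [edist_dist, edist_dist, Real.dist_eq, Real.dist_eq, Real.coe_toNNReal _ hα.le,
      ENNReal.ofReal_rpow_of_nonneg (abs_nonneg _) hα.le]
    change _ ≤ ENNReal.ofReal K * _
    rw [← ENNReal.ofReal_mul hK0.le]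
    exact ENNReal.ofReal_le_ofReal ((h1.trans_eq h3).trans h4)
  have h1 := hhol.hausdorffMeasure_image_le (Real.toNNReal_pos.mpr hα) zero_le_one
  rw [mul_one, Real.coe_toNNReal _ hα.le, hausdorffMeasure_real] at h1
  have h2 : Icc (0 : ℝ) 1 ⊆ f '' cantor l := by
    intro y hy
    obtain ⟨a, -, ha⟩ := Real.ofDigits_SurjOn (b := 2) (by norm_num) hy
    exact ⟨_, ⟨a, rfl⟩, (hfa a).trans ha⟩
  have h3 := (measure_mono h2).trans h1
  rw [Real.volume_Icc] at h3
  by_contra hcon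
  rw [not_lt, nonpos_iff_eq_zero] at hcon
  rw [hcon] at h3
  simp at h3

/-- Balls are comparable to pieces: a piece of diameter just below `r` fits in the ball, and by
separation the part of the set in the ball lies in one piece of size comparable to `r`. -/
theorem isRegularSet_cantor {l : ℝ} (hl0 : 0 < l) (hl : l < 1)
    {α : ℝ} (hα : 0 < α) (hl2 : 2 * l < 1)
    (hlα : l ^ α = 1 / 2) : IsRegularSet α (cantor l) := by
  have hc : 0 < 1 - 2 * l := by linarith
  have hpos := hausdorffMeasure_cantor_pos hl0 hl hα hl2 hlα
  have hfin : μH[α] (cantor l) ≠ ∞ :=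
    ((hausdorffMeasure_cantor_le_one hl0 hl hα hlα).trans_lt ENNReal.one_lt_top).ne
  set M := (μH[α] (cantor l)).toReal
  have hM : μH[α] (cantor l) = ENNReal.ofReal M := (ENNReal.ofReal_toReal hfin).symm
  have hM0 : 0 < M := ENNReal.toReal_pos hpos.ne' hfin
  -- `A` serves the upper bound and `B` the lower one, so `A + B⁻¹` serves both.
  set A := M * (((1 - 2 * l) * l)⁻¹) ^ α with hA
  set B := l ^ α * M with hB
  have hA0 : 0 < A := by positivity
  have hB0 : 0 < B := by positivity
  refine ⟨isCompact_cantor hl0 hl, range_nonempty _, A + B⁻¹, by positivity, ?_⟩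
  rintro _ ⟨a, rfl⟩ r hr hr1
  constructor
  · obtain ⟨n, hn1, hn2⟩ := exists_nat_pow_near_of_lt_one hr hr1 hl0 hl
    have hsub : cantorPiece l (n + 1) a ⊆ cantor l ∩ Metric.closedBall (cantorPoint l a) r :=
      subset_inter (image_subset_range _ _) ((cantorPiece_subset_closedBall hl0 hl _ a).trans
        (Metric.closedBall_subset_closedBall hn1.le))
    refine le_trans ?_ (measure_mono hsub)
    rw [hausdorffMeasure_cantorPiece hl0 hl hα.le, hM, ← ENNReal.ofReal_mul (by positivity)]
    refine ENNReal.ofReal_le_ofReal ?_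
    have h1 : (A + B⁻¹)⁻¹ ≤ B := inv_le_of_inv_le₀ hB0 (by linarith)
    calc (A + B⁻¹)⁻¹ * r ^ α ≤ B * r ^ α := by gcongr
      _ = (l * r) ^ α * M := by rw [hB, Real.mul_rpow hl0.le hr.le]; ring
      _ ≤ (l ^ (n + 1)) ^ α * M := by
        gcongr
        rw [pow_succ']
        gcongr
  -- Used with `t = l^n` when `r ≤ 1 - 2l`, and with `t = 1`, the whole set, for larger `r`.
  · have hbound : ∀ t : ℝ, 0 ≤ t → t ≤ r * ((1 - 2 * l) * l)⁻¹ →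
        t ^ α * M ≤ (A + B⁻¹) * r ^ α := by
      intro t ht0 ht
      calc t ^ α * M ≤ (r * ((1 - 2 * l) * l)⁻¹) ^ α * M := by gcongr
        _ = A * r ^ α := by rw [hA, Real.mul_rpow hr.le (by positivity)]; ring
        _ ≤ _ := by
          gcongr
          linarith [inv_pos.mpr hB0]
    rcases le_or_gt r (1 - 2 * l) with hrc | hrc
    · obtain ⟨n, hn1, hn2⟩ := exists_nat_pow_near_of_lt_one (x := r / (1 - 2 * l))
        (by positivity) ((div_le_one hc).mpr hrc) hl0 hl
      have hsub : cantor l ∩ Metric.closedBall (cantorPoint l a) r ⊆ cantorPiece l n a := by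
        rintro _ ⟨⟨b, rfl⟩, hb⟩
        by_cases hab : b = a
        · subst hab
          exact ⟨b, PiNat.self_mem_cylinder b n, rfl⟩
        refine ⟨b, (PiNat.mem_cylinder_iff_le_firstDiff hab n).mpr ?_, rfl⟩
        have h1 := le_abs_cantorPoint_sub hl0 hl hab
        rw [Metric.mem_closedBall, Real.dist_eq] at hb
        have h2 : l ^ PiNat.firstDiff b a ≤ l ^ n := by
          rw [div_le_iff₀ hc] at hn2
          have := (h1.trans hb).trans hn2
          rw [mul_comm] at this
          exact le_of_mul_le_mul_right this hc
        exact (pow_le_pow_iff_right_of_lt_one₀ hl0 hl).mp h2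
      refine (measure_mono hsub).trans ?_
      rw [hausdorffMeasure_cantorPiece hl0 hl hα.le, hM, ← ENNReal.ofReal_mul (by positivity)]
      refine ENNReal.ofReal_le_ofReal (hbound _ (by positivity) ?_)
      rw [pow_succ, lt_div_iff₀ hc] at hn1
      rw [← div_eq_mul_inv, le_div_iff₀ (by positivity)]
      nlinarith
    · refine (measure_mono inter_subset_left).trans ?_
      rw [hM]
      refine ENNReal.ofReal_le_ofReal ?_
      have h1 := hbound 1 zero_le_one (by
        rw [← div_eq_mul_inv, le_div_iff₀ (by positivity)]
        nlinarith)
      simpa using h1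

/-- Regular sets of every dimension in `[0, 1)` exist in the unit interval. -/
theorem exists_isRegularSet {α : ℝ} (h0 : 0 ≤ α) (h1 : α < 1) :
    ∃ C : Set ℝ, C ⊆ Icc 0 1 ∧ IsRegularSet α C ∧
      (0 < α → Perfect C ∧ IsTotallyDisconnected C) := by
  rcases h0.eq_or_lt with rfl | hα
  · exact ⟨{0}, by simp, isRegularSet_zero_singleton 0, fun h => absurd h (lt_irrefl 0)⟩
  -- The solution of `l^α = 1/2`; here `α < 1` amounts to `l < 1/2`, the separation condition.
  · set l : ℝ := (1 / 2) ^ α⁻¹ with hl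
    have hl0 : 0 < l := by positivity
    have hl2 : 2 * l < 1 := by
      have : l < (1 / 2 : ℝ) ^ (1 : ℝ) :=
        Real.rpow_lt_rpow_of_exponent_gt (by norm_num) (by norm_num) (one_lt_inv_iff₀.mpr ⟨hα, h1⟩)
      rw [Real.rpow_one] at this
      linarith
    have hl1 : l < 1 := by linarith
    have hlα : l ^ α = 1 / 2 := by
      rw [hl, ← Real.rpow_mul (by norm_num), inv_mul_cancel₀ hα.ne', Real.rpow_one]
    have hreg := isRegularSet_cantor hl0 hl1 hα hl2 hlα
    refine ⟨cantor l, ?_, hreg, fun _ => ⟨hreg.perfect hα, hreg.isTotallyDisconnected h1⟩⟩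
    rintro _ ⟨a, rfl⟩
    exact cantorPoint_mem_Icc hl0 hl1 a

end ProjLp

theorem mainTheorem6 (d n : ℕ) (hd : 2 ≤ d) (hn : 0 < n) (hnd : n < d)
    (s : ℝ) (hs : (d : ℝ) - 1 ≤ s) (hsd : s < d) :
    -- regular Cantor sets of the required dimension exist
    (∃ C : Set ℝ, C ⊆ Set.Icc 0 1 ∧ ProjLp.IsRegularSet (s - d + 1) C ∧
      ((d : ℝ) - 1 < s → Perfect C ∧ IsTotallyDisconnected C)) ∧
    -- for each of them the measure is `s`-Frostman, with divergence above the critical exponent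
    (∀ C : Set ℝ, ProjLp.IsRegularSet (s - d + 1) C →
      ProjLp.IsFrostman s (ProjLp.exampleMeasure d s C) ∧
      ∀ p : ℝ, (2 * d - n - s) / (d - s) < p →
        ProjLp.projLpIntegral (n := n) hnd.le p (ProjLp.exampleMeasure d s C) = ⊤) ∧
    -- hence no exponent above the critical one is admissible for all `s`-Frostman measures
    (∀ p : ℝ, (2 * d - n - s) / (d - s) < p →
      ∃ μ : MeasureTheory.Measure (ProjLp.E d), ProjLp.IsFrostman s μ ∧
        ProjLp.projLpIntegral (n := n) hnd.le p μ = ⊤) := by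
  have hd0 : 0 < d := by omega
  obtain ⟨C, hC01, hC, htop⟩ := ProjLp.exists_isRegularSet (α := s - d + 1) (by linarith)
    (by linarith)
  refine ⟨⟨C, hC01, hC, fun h => htop (by linarith)⟩, fun C' hC' => ?_, fun p hp => ?_⟩
  · exact ⟨ProjLp.isFrostman_exampleMeasure hd0 hs hC', fun p hp =>
      ProjLp.projLpIntegral_exampleMeasure_eq_top hn hnd hsd hC' hp⟩
  · exact ⟨_, ProjLp.isFrostman_exampleMeasure hd0 hs hC,
      ProjLp.projLpIntegral_exampleMeasure_eq_top hn hnd hsd hC hp⟩
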